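/- Let $\mathbb S=\mathbb R/\mathbb Z$, let $f:\mathbb R^n\times\mathbb R^m\to\mathbb R^n$ be continuously differentiable, let $p\in\mathbb R^m$, $T\in\mathbb R$, let $\rho$ be irrational, and let $v:\mathbb S\times[0,1]\to\mathbb R^n$ be a continuously differentiable solution of $$\partial_\tau v=Tf(v,p),\qquad v(\phi,1)=v(\phi+\rho,0).$$ Let $h_1,h_2$ be two functionals (phase conditions) with $h_1(v,p)=h_2(v,p)=0$, whose variations at $(v,p)$ are $\int_{\mathbb S}\int_0^1 \partial_vh_i(\phi,\tau)\,\delta_v(\phi,\tau)\,d\tau\,d\phi+\partial_ph_i\,\delta_p$ with continuous row-vector kernels $\partial_vh_i$, and suppose that the $2\times2$ matrix $\int_{\mathbb S}\int_0^1\begin{bmatrix}\partial_vh_1\\ \partial_vh_2\end{bmatrix}\begin{bmatrix}\partial_\tau v&\partial_\phi v\end{bmatrix}d\tau\,d\phi$ is nonsingular. Let $V$ solve $\partial_\tau V=T\partial_xf(v,p)V$, $V(\cdot,0)=I_n$. Suppose that $v$ is normally hyperbolic in the following sense: there are $q_\tau,q_\phi:\mathbb S\times[0,1]\to\mathbb R^n$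 such that $q_{\rm tg}:=\partial_\tau v\,q_\tau^{\mathsf T}+\partial_\phi v\,q_\phi^{\mathsf T}$ is a continuous family of projections onto the tangent spaces $\mathrm{span}\{\partial_\tau v,\partial_\phi v\}$ with $q_{\rm tg}(\phi,1)=q_{\rm tg}(\phi+\rho,0)$ and $q_{\rm tg}(\phi,\tau)V(\phi,\tau)=V(\phi,\tau)q_{\rm tg}(\phi,0)$; and, with $q_{\rm tr}:=I_n-q_{\rm tg}$, the map $\Gamma_{\rho,0}[\delta](\phi)=V(\phi-\rho,1)\delta(\phi-\rho)-\delta(\phi)$ is a bijection with bounded inverse (supremum norm) of the space $\{\phi\mapsto q_{\rm tr}(\phi,0)\delta(\phi):\delta\in C(\mathbb S,\mathbb R^n)\}$ onto itself. For $\eta_T,\eta_\rho\in\mathbb R$ consider the adjoint conditions for the unknowns $\lambda_{\rm de}:\mathbb S\times[0,1]\to\mathbb R^n$, $\lambda_{\rm bc}:\mathbb S\to\mathbb R^n$, $\lambda_{\rm ps}\in\mathbb R^2$, $\eta_p\in\mathbb R^m$: $$0=-\partial_\tau\lambda_{\rm de}^{\mathsf T}-T\lambda_{\rm de}^{\mathsf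 T}\partial_xf(v,p)+\lambda_{\rm ps}^{\mathsf T}\partial_vh,\quad 0=\lambda_{\rm de}(\phi,1)-\lambda_{\rm bc}(\phi),\quad 0=-\lambda_{\rm de}(\phi,0)+\lambda_{\rm bc}(\phi-\rho),$$ $$0=-\int_{\mathbb S}\int_0^1\lambda_{\rm de}^{\mathsf T}f(v,p)\,d\tau\,d\phi+\eta_T,\qquad 0=\int_{\mathbb S}\lambda_{\rm bc}^{\mathsf T}(\phi)\,\partial_\phi v(\phi+\rho,0)\,d\phi+\eta_\rho,$$ $$0=-\int_{\mathbb S}\int_0^1\lambda_{\rm de}^{\mathsf T}T\partial_pf(v,p)\,d\tau\,d\phi+\eta_p^{\mathsf T}+\lambda_{\rm ps}^{\mathsf T}\partial_ph .$$ Then: 1. For all $\eta_T,\eta_\rho$, every solution with continuous $\lambda_{\rm bc}$ (in particular every continuous solution) has $\lambda_{\rm ps}=0$ and $$\lambda_{\rm de}(\phi,\tau)=T\eta_T\,q_\tau(\phi,\tau)-\eta_\rho\,q_\phi(\phi,\tau)\quad\text{for all }(\phi,\tau).$$ 2. For $(\eta_T,\eta_\rho)=(1,0)$ there is exactly one solution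 with continuous $\lambda_{\rm bc}$; its $\lambda_{\rm de}$ is continuous and equals $Tq_\tau$. For $(\eta_T,\eta_\rho)=(0,1)$ there is exactly one solution with continuous $\lambda_{\rm bc}$; its $\lambda_{\rm de}$ is continuous and equals $-q_\phi$. 3. The linearized problem has no bounded inverse: for the linear map sending $(\delta_v,\delta_T,\delta_\rho,\delta_p)$, where $\delta_v:\mathbb S\times[0,1]\to\mathbb R^n$ is continuous with continuous $\partial_\tau\delta_v$, to $(\delta_{\rm ode},\delta_{\rm bc},\delta_h,\delta_p)$, $$\delta_{\rm ode}=\partial_\tau\delta_v-T\partial_xf(v,p)\delta_v-f(v,p)\delta_T-T\partial_pf(v,p)\delta_p,\quad \delta_{\rm bc}=\delta_v(\cdot+\rho,0)-\delta_v(\cdot,1)+\partial_\phi v(\cdot+\rho,0)\delta_\rho,$$ $$\delta_h=\int_{\mathbb S}\int_0^1\partial_vh\,\delta_v\,d\tau\,d\phi+\partial_ph\,\delta_p,$$ there is no constant $C$ such that $\|(\delta_v,\delta_T,\delta_\rho,\delta_p)\|\le C\,\|(\delta_{\rm ode},\delta_{\rm bc},\delta_h,\delta_p)\|$ always holds (supremum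 norms). -/

import Mathlib

open MeasureTheory Set

noncomputable section

namespace QPTorus

/-- The circle `𝕊 = ℝ / ℤ`. -/
abbrev Circ : Type := UnitAddCircle

/-- The cylinder `𝕊 × [0,1]`, with points `(φ, τ)`. -/
abbrev Cyl : Type := Circ × unitInterval

/-- The state space `ℝⁿ`, also used for the parameter space `ℝ^m`. -/
abbrev Vec (n : ℕ) : Type := EuclideanSpace ℝ (Fin n)

section Calculus

variable {F : Type*}

/-- The curve `s ↦ w (φ, s)`. It is only ever used for `s ∈ [0,1]`;
outside this interval it is extended by its end values. -/
def slice (w : Cyl → F) (φ : Circ) (s : ℝ) : F :=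
  w (φ, projIcc (0 : ℝ) 1 zero_le_one s)

variable [NormedAddCommGroup F] [NormedSpace ℝ F]

/-- The partial derivative `∂_τ w` (one-sided at `τ = 0` and `τ = 1`). -/
def dTau (w : Cyl → F) (z : Cyl) : F :=
  derivWithin (slice w z.1) (Icc 0 1) (z.2 : ℝ)

/-- The partial derivative `∂_φ w`. -/
def dPhi (w : Cyl → F) (z : Cyl) : F :=
  deriv (fun s : ℝ => w (z.1 + (s : Circ), z.2)) 0

/-- `w` is continuously differentiable on `𝕊 × [0,1]`. -/
def IsC1 (w : Cyl → F) : Prop :=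
  ContDiffOn ℝ 1 (fun x : ℝ × ℝ => slice w (x.1 : Circ) x.2) (univ ×ˢ Icc (0 : ℝ) 1)

/-- `w` has a continuous partial derivative with respect to `τ` on `𝕊 × [0,1]`. -/
def HasContDTau (w : Cyl → F) : Prop :=
  (∀ z : Cyl, DifferentiableWithinAt ℝ (slice w z.1) (Icc 0 1) (z.2 : ℝ)) ∧
    Continuous (dTau w)

end Calculus

/-- The iterated integral `∫_𝕊 ∫_0^1 g(φ,τ) dτ dφ`. -/
def cylInt (g : Cyl → ℝ) : ℝ :=
  ∫ φ : Circ, ∫ s in (0 : ℝ)..1, slice g φ s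

variable {n m : ℕ}

/-- `∂_x f(x,p)`. -/
def dfx (f : Vec n → Vec m → Vec n) (x : Vec n) (p : Vec m) : Vec n →L[ℝ] Vec n :=
  fderiv ℝ (fun y => f y p) x

/-- `∂_p f(x,p)`. -/
def dfp (f : Vec n → Vec m → Vec n) (x : Vec n) (p : Vec m) : Vec m →L[ℝ] Vec n :=
  fderiv ℝ (fun r => f x r) p

/-- `v` is a continuously differentiable solution of the boundary-value problem
`∂_τ v = T f(v,p)`, `v(φ,1) = v(φ+ρ,0)` on `𝕊 × [0,1]`. -/
structure IsTorusSolution (f : Vec n → Vec m → Vec n) (p : Vec m) (T ρ : ℝ)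
    (v : C(Cyl, Vec n)) : Prop where
  c1 : IsC1 v
  ode : ∀ (φ : Circ) (τ : unitInterval),
    HasDerivWithinAt (slice v φ) (T • f (v (φ, τ)) p) (Icc 0 1) (τ : ℝ)
  bc : ∀ φ : Circ, v (φ, 1) = v (φ + (ρ : Circ), 0)

/-- `V` is the solution of the variational initial-value problem
`∂_τ V = T ∂_x f(v,p) V`, `V(·,0) = I`. -/
structure IsVariational (f : Vec n → Vec m → Vec n) (p : Vec m) (T : ℝ)
    (v : C(Cyl, Vec n)) (V : Cyl → Vec n →L[ℝ] Vec n) : Prop where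
  init : ∀ φ : Circ, V (φ, 0) = ContinuousLinearMap.id ℝ (Vec n)
  ode : ∀ (φ : Circ) (τ : unitInterval),
    HasDerivWithinAt (slice V φ) (T • (dfx f (v (φ, τ)) p).comp (V (φ, τ)))
      (Icc 0 1) (τ : ℝ)

/-- The functions `k i` and the linear forms `kp i` are the derivatives `∂_v h_i(v,p)` (as
integral kernels) and `∂_p h_i(v,p)` of the functionals `h_i`: the variation of `h_i` in every
continuously differentiable direction `δ` and every `δp` is
`∫_𝕊 ∫_0^1 k_iᵀ δ dτ dφ + kp_i δp`. -/
def IsPhaseDeriv (h : Fin 2 → C(Cyl, Vec n) → Vec m → ℝ) (v : C(Cyl, Vec n)) (p : Vec m)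
    (k : Fin 2 → C(Cyl, Vec n)) (kp : Fin 2 → Vec m →L[ℝ] ℝ) : Prop :=
  ∀ (i : Fin 2) (δ : C(Cyl, Vec n)) (δp : Vec m), IsC1 δ →
    HasDerivAt (fun s : ℝ => h i (v + s • δ) (p + s • δp))
      (cylInt (fun z => inner ℝ (k i z) (δ z)) + kp i δp) 0

/-- The `2 × 2` matrix `∫_𝕊 ∫_0^1 [∂_v h_1; ∂_v h_2] [∂_τ v, ∂_φ v] dτ dφ`. -/
def phaseMatrix (k : Fin 2 → C(Cyl, Vec n)) (v : C(Cyl, Vec n)) : Matrix (Fin 2) (Fin 2) ℝ :=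
  Matrix.of fun i => ![cylInt (fun z => inner ℝ (k i z) (dTau v z)),
    cylInt (fun z => inner ℝ (k i z) (dPhi v z))]

/-- `q_tg = ∂_τ v q_τᵀ + ∂_φ v q_φᵀ`. -/
def qtg (v : C(Cyl, Vec n)) (qτ qφ : Cyl → Vec n) (z : Cyl) : Vec n →L[ℝ] Vec n :=
  (innerSL ℝ (qτ z)).smulRight (dTau v z) + (innerSL ℝ (qφ z)).smulRight (dPhi v z)

/-- `q_tr = I - q_tg`. -/
def qtr (v : C(Cyl, Vec n)) (qτ qφ : Cyl → Vec n) (z : Cyl) : Vec n →L[ℝ] Vec n :=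
  ContinuousLinearMap.id ℝ (Vec n) - qtg v qτ qφ z

/-- `Γ_{ρ,0}[δ](φ) = V(φ-ρ,1) δ(φ-ρ) - δ(φ)`. -/
def Gam (V : Cyl → Vec n →L[ℝ] Vec n) (ρ : ℝ) (δ : Circ → Vec n) (φ : Circ) : Vec n :=
  V (φ - (ρ : Circ), 1) (δ (φ - (ρ : Circ))) - δ φ

/-- The space of functions `φ ↦ q_tr(φ,0) δ(φ)`, `δ` continuous on `𝕊`. -/
def transversal (v : C(Cyl, Vec n)) (qτ qφ : Cyl → Vec n) : Set (Circ → Vec n) :=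
  {γ | ∃ δ : Circ → Vec n, Continuous δ ∧ γ = fun φ => qtr v qτ qφ (φ, 0) (δ φ)}

/-- The torus `v` is normally hyperbolic, with tangential projection
`q_tg = ∂_τ v q_τᵀ + ∂_φ v q_φᵀ`: the `q_tg` form a continuous invariant family of projections
onto the tangent spaces, and `Γ_{ρ,0}` is a bijection with bounded inverse (in the supremum norm)
on the space of continuous transversal perturbations. -/
structure IsNormallyHyperbolic (ρ : ℝ) (v : C(Cyl, Vec n)) (V : Cyl → Vec n →L[ℝ] Vec n)
    (qτ qφ : Cyl → Vec n) : Prop where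
  cont : Continuous (qtg v qτ qφ)
  idem : ∀ z, (qtg v qτ qφ z).comp (qtg v qτ qφ z) = qtg v qτ qφ z
  range_eq : ∀ z, LinearMap.range (qtg v qτ qφ z).toLinearMap =
    Submodule.span ℝ {dTau v z, dPhi v z}
  shift : ∀ φ : Circ, qtg v qτ qφ (φ, 1) = qtg v qτ qφ (φ + (ρ : Circ), 0)
  invariant : ∀ (φ : Circ) (τ : unitInterval),
    (qtg v qτ qφ (φ, τ)).comp (V (φ, τ)) = (V (φ, τ)).comp (qtg v qτ qφ (φ, 0))
  bijOn : BijOn (Gam V ρ) (transversal v qτ qφ) (transversal v qτ qφ)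
  bounded : ∃ C : ℝ, ∀ δ ∈ transversal v qτ qφ, ∀ ε : ℝ,
    (∀ φ, ‖Gam V ρ δ φ‖ ≤ ε) → ∀ φ, ‖δ φ‖ ≤ C * ε

/-- The unknowns `(λ_de, λ_bc, λ_ps, η_p)` of the adjoint conditions for given `(η_T, η_ρ)`. -/
@[ext]
structure AdjointVars (n m : ℕ) where
  de : Cyl → Vec n
  bc : Circ → Vec n
  ps : Fin 2 → ℝ
  ηp : Vec m

/-- The adjoint conditions, one for each of the variations
`δv(φ,τ)`, `δv(φ,1)`, `δv(φ,0)`, `δT`, `δρ`, `δp`. -/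
structure IsAdjointSolution (f : Vec n → Vec m → Vec n) (p : Vec m) (T ρ : ℝ)
    (v : C(Cyl, Vec n)) (k : Fin 2 → C(Cyl, Vec n)) (kp : Fin 2 → Vec m →L[ℝ] ℝ)
    (ηT ηρ : ℝ) (X : AdjointVars n m) : Prop where
  var_v : ∀ (φ : Circ) (τ : unitInterval),
    HasDerivWithinAt (slice X.de φ)
      (-(T • ContinuousLinearMap.adjoint (dfx f (v (φ, τ)) p) (X.de (φ, τ)))
        + ∑ i, X.ps i • k i (φ, τ)) (Icc 0 1) (τ : ℝ)
  var_v1 : ∀ φ : Circ, 0 = X.de (φ, 1) - X.bc φ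
  var_v0 : ∀ φ : Circ, 0 = -X.de (φ, 0) + X.bc (φ - (ρ : Circ))
  var_T : 0 = -cylInt (fun z => inner ℝ (X.de z) (f (v z) p)) + ηT
  var_ρ : 0 = (∫ φ : Circ, inner ℝ (X.bc φ) (dPhi v (φ + (ρ : Circ), 0))) + ηρ
  var_p : ∀ δp : Vec m,
    0 = -cylInt (fun z => inner ℝ (X.de z) (T • dfp f (v z) p δp)) + inner ℝ X.ηp δp
      + ∑ i, X.ps i * kp i δp

/-- First component of the linearized problem:
`∂_τ δ_v - T ∂_x f(v,p) δ_v - f(v,p) δ_T - T ∂_p f(v,p) δ_p`. -/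
def linOde (f : Vec n → Vec m → Vec n) (p : Vec m) (T : ℝ) (v δv : C(Cyl, Vec n))
    (δT : ℝ) (δp : Vec m) (z : Cyl) : Vec n :=
  dTau δv z - T • dfx f (v z) p (δv z) - δT • f (v z) p - T • dfp f (v z) p δp

/-- Second component of the linearized problem:
`δ_v(φ+ρ,0) - δ_v(φ,1) + ∂_φ v(φ+ρ,0) δ_ρ`. -/
def linBc (ρ : ℝ) (v δv : C(Cyl, Vec n)) (δρ : ℝ) (φ : Circ) : Vec n :=
  δv (φ + (ρ : Circ), 0) - δv (φ, 1) + δρ • dPhi v (φ + (ρ : Circ), 0)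

/-- Third component of the linearized problem:
`∫_𝕊 ∫_0^1 ∂_v h_i δ_v dτ dφ + ∂_p h_i δ_p`. -/
def linPhase (k : Fin 2 → C(Cyl, Vec n)) (kp : Fin 2 → Vec m →L[ℝ] ℝ) (δv : C(Cyl, Vec n))
    (δp : Vec m) (i : Fin 2) : ℝ :=
  cylInt (fun z => inner ℝ (k i z) (δv z)) + kp i δp

/-- The estimate `‖(δ_v, δ_T, δ_ρ, δ_p)‖ ≤ C ‖(δ_ode, δ_bc, δ_h, δ_p)‖` (supremum norms) for the
linearized problem `(δ_v, δ_T, δ_ρ, δ_p) ↦ (δ_ode, δ_bc, δ_h, δ_p)` on the space of continuous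
`δ_v` with continuous `∂_τ δ_v`. Any bounded inverse (or merely bounded left inverse) of the
linearized problem yields it. -/
def LinearizationBound (f : Vec n → Vec m → Vec n) (p : Vec m) (T ρ : ℝ)
    (v : C(Cyl, Vec n)) (k : Fin 2 → C(Cyl, Vec n)) (kp : Fin 2 → Vec m →L[ℝ] ℝ)
    (C : ℝ) : Prop :=
  ∀ (δv : C(Cyl, Vec n)) (δT δρ : ℝ) (δp : Vec m) (ε : ℝ), HasContDTau δv →
    (∀ z, ‖linOde f p T v δv δT δp z‖ ≤ ε) →
    (∀ φ, ‖linBc ρ v δv δρ φ‖ ≤ ε) →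
    (∀ i, |linPhase k kp δv δp i| ≤ ε) →
    ‖δp‖ ≤ ε →
    (∀ z, ‖δv z‖ ≤ C * ε) ∧ |δT| ≤ C * ε ∧ |δρ| ≤ C * ε ∧ ‖δp‖ ≤ C * ε

end QPTorus

end

/-! The fields `∂_τ v` and `∂_φ v` both solve the variational equation and match across the boundary
under rotation by `ρ`. Pair `λ_de` with such a field `w`. The `τ`-derivative of the pairing is
`λ_psᵀ ∂_v h w`, and the boundary terms cancel after integration over the circle because Lebesgue
measure is rotation invariant. So `λ_ps` lies in the left kernel of the phase matrix and vanishes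
(`ps_eq_zero`). The pairings are then constant in `τ` and invariant under an irrational rotation,
hence constant (`exists_inner_eq`); the `η_T` and `η_ρ` conditions fix the constants as `T η_T` and
`-η_ρ`.

On transversal vectors, write `β = λ_de(·,0)`. The integral of `⟨β, Γδ⟩` is zero for every
transversal `δ`, again by rotation invariance. Surjectivity of `Γ` allows `Γδ = q_tr q_trᵀ β`, so `∫
‖q_trᵀ β‖² = 0` (`inner_qtr_eq_zero`). Tangential and transversal values together determine `λ_de`
(`de_eq`). Conversely, `q_τ` and `q_φ` are transported by `V`, so they solve the adjoint equation
and supply the solution (`exists_isAdjointSolution`).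

Boundedness fails through small divisors: by Dirichlet approximation there are functions `g` on the
circle of size one that are almost invariant under the rotation, and `g ∂_φ v` is then an
almost-solution of the homogeneous linearized problem (`not_linearizationBound`). -/

noncomputable section

namespace QPTorus

open scoped RealInnerProductSpace

/-! ### Slices in `τ` and uniqueness for linear differential equations -/

section Slices

variable {F : Type*}

@[simp]
lemma slice_coe (w : Cyl → F) (φ : Circ) (τ : unitInterval) : slice w φ (τ : ℝ) = w (φ, τ) := by
  simp [slice]

lemma slice_of_mem (w : Cyl → F) (φ : Circ) {t : ℝ} (ht : t ∈ Icc (0 : ℝ) 1) :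
    slice w φ t = w (φ, ⟨t, ht⟩) := slice_coe w φ ⟨t, ht⟩

lemma continuous_slice_uncurry [TopologicalSpace F] {w : Cyl → F} (hw : Continuous w) :
    Continuous (Function.uncurry (slice w)) :=
  hw.comp (continuous_fst.prodMk (continuous_projIcc.comp continuous_snd))

lemma continuous_slice [TopologicalSpace F] {w : Cyl → F} (hw : Continuous w) (φ : Circ) :
    Continuous (slice w φ) :=
  (continuous_slice_uncurry hw).comp (Continuous.prodMk_right φ)

variable [NormedAddCommGroup F] [NormedSpace ℝ F]

lemma dTau_eq_of_hasDerivWithinAt {w : Cyl → F} {φ : Circ} {τ : unitInterval} {w' : F}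
    (hw : HasDerivWithinAt (slice w φ) w' (Icc 0 1) (τ : ℝ)) : dTau w (φ, τ) = w' :=
  hw.derivWithin (uniqueDiffOn_Icc zero_lt_one _ τ.2)

/-- A solution of a linear differential equation that vanishes once vanishes identically. -/
lemma eq_zero_of_linear_ode {A : Cyl → F →L[ℝ] F} (hA : Continuous A) {w : Cyl → F} {φ : Circ}
    (hw : ∀ τ : unitInterval,
      HasDerivWithinAt (slice w φ) (A (φ, τ) (w (φ, τ))) (Icc 0 1) (τ : ℝ))
    {τ₀ : unitInterval} (h0 : w (φ, τ₀) = 0) (τ : unitInterval) : w (φ, τ) = 0 := by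
  obtain ⟨K, hK⟩ : ∃ K : ℝ, ∀ z, ‖A z‖ ≤ K := by
    obtain ⟨K, hK⟩ := isCompact_univ.exists_bound_of_continuousOn hA.continuousOn
    exact ⟨K, fun z => hK z (mem_univ z)⟩
  have hlip : ∀ t : ℝ, LipschitzWith K.toNNReal (fun x => slice A φ t x) := fun t =>
    (slice A φ t).lipschitz.weaken (by
      rw [← NNReal.coe_le_coe]
      exact (hK _).trans (Real.le_coe_toNNReal K))
  have hd : ∀ t ∈ Icc (0 : ℝ) 1,
      HasDerivWithinAt (slice w φ) (slice A φ t (slice w φ t)) (Icc 0 1) t := by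
    intro t ht
    rw [slice_of_mem w φ ht, slice_of_mem A φ ht]
    exact hw ⟨t, ht⟩
  have hc : ContinuousOn (slice w φ) (Icc 0 1) := fun t ht => (hd t ht).continuousWithinAt
  have hz : ∀ (t : ℝ) (s : Set ℝ),
      HasDerivWithinAt (fun _ : ℝ => (0 : F)) (slice A φ t 0) s t := by
    intro t s
    rw [map_zero]
    exact hasDerivWithinAt_const _ _ _
  rw [← slice_coe w φ τ]
  -- The zero may sit anywhere in `[0,1]`: uniqueness is applied backwards on `[0, τ₀]` and forwards
  -- on `[τ₀, 1]`.
  rcases le_total (τ : ℝ) τ₀ with hle | hle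
  · refine ODE_solution_unique_of_mem_Icc_left (v := fun t x => slice A φ t x)
      (s := fun _ => univ) (a := 0) (b := τ₀) (g := fun _ => 0)
      (fun t _ => (hlip t).lipschitzOnWith) (hc.mono (Icc_subset_Icc_right τ₀.2.2)) ?_
      (fun _ _ => mem_univ _) continuousOn_const (fun t _ => hz t _) (fun _ _ => mem_univ _)
      (by simpa using h0) ⟨τ.2.1, hle⟩
    intro t ht
    exact (hd t ⟨ht.1.le, ht.2.trans τ₀.2.2⟩).mono_of_mem_nhdsWithin
      (Filter.mem_of_superset (Icc_mem_nhdsLE ht.1)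
        (Icc_subset_Icc_right (ht.2.trans τ₀.2.2)))
  · refine ODE_solution_unique_of_mem_Icc_right (v := fun t x => slice A φ t x)
      (s := fun _ => univ) (a := τ₀) (b := 1) (g := fun _ => 0)
      (fun t _ => (hlip t).lipschitzOnWith) (hc.mono (Icc_subset_Icc_left τ₀.2.1)) ?_
      (fun _ _ => mem_univ _) continuousOn_const (fun t _ => hz t _) (fun _ _ => mem_univ _)
      (by simpa using h0) ⟨hle, τ.2.2⟩
    intro t ht
    exact (hd t ⟨τ₀.2.1.trans ht.1, ht.2.le⟩).mono_of_mem_nhdsWithin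
      (Filter.mem_of_superset (Icc_mem_nhdsGE ht.2)
        (Icc_subset_Icc_left (τ₀.2.1.trans ht.1)))

end Slices

/-! ### Irrational rotations of the circle -/

section Rotation

/-- The full `ℤ`-orbit of `φ₀` stays in `S`, and it is dense because `ρ` is irrational. It is
applied to zero sets and to level sets. -/
lemma eq_univ_of_rotation_invariant {ρ : ℝ} (hρ : Irrational ρ) {S : Set Circ} (hS : IsClosed S)
    (hinv : ∀ φ, φ ∈ S ↔ φ + (ρ : Circ) ∈ S) {φ₀ : Circ} (h0 : φ₀ ∈ S) : S = univ := by
  have hd : DenseRange (· • (ρ : Circ) : ℤ → Circ) :=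
    AddCircle.denseRange_zsmul_coe_iff.2 (by simpa using hρ)
  have hd' : DenseRange fun j : ℤ => φ₀ + j • (ρ : Circ) :=
    (Homeomorph.addLeft φ₀).surjective.denseRange.comp hd (Homeomorph.addLeft φ₀).continuous
  have hmem : ∀ j : ℤ, φ₀ + j • (ρ : Circ) ∈ S := by
    intro j
    induction j with
    | zero => simpa using h0
    | succ j ih =>
      rw [add_smul, one_smul, ← add_assoc]
      exact (hinv _).1 ih
    | pred j ih =>
      refine (hinv _).2 ?_
      rwa [sub_smul, one_smul, add_assoc, sub_add_cancel]
  rw [← hS.closure_eq]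
  exact (Dense.mono (range_subset_iff.2 hmem) hd').closure_eq

lemma const_of_rotation_invariant {Y : Type*} [TopologicalSpace Y] [T1Space Y] {ρ : ℝ}
    (hρ : Irrational ρ) {g : Circ → Y} (hg : Continuous g)
    (hinv : ∀ φ, g (φ + (ρ : Circ)) = g φ) (φ ψ : Circ) : g φ = g ψ := by
  have := eq_univ_of_rotation_invariant hρ (S := g ⁻¹' {g ψ}) (isClosed_singleton.preimage hg)
    (fun φ => by simp [hinv]) (φ₀ := ψ) rfl
  exact (this ▸ mem_univ φ : φ ∈ g ⁻¹' {g ψ})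

end Rotation

/-! ### The iterated integral over the cylinder -/

section Integral

lemma continuous_sliceIntegral {g : Cyl → ℝ} (hg : Continuous g) :
    Continuous fun φ : Circ => ∫ s in (0 : ℝ)..1, slice g φ s :=
  intervalIntegral.continuous_parametric_intervalIntegral_of_continuous'
    (continuous_slice_uncurry hg) 0 1

lemma integrable_circ {g : Circ → ℝ} (hg : Continuous g) : Integrable g :=
  hg.integrable_of_hasCompactSupport (HasCompactSupport.of_compactSpace g)

lemma cylInt_add {g g' : Cyl → ℝ} (hg : Continuous g) (hg' : Continuous g') :
    cylInt (fun z => g z + g' z) = cylInt g + cylInt g' := by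
  unfold cylInt
  rw [← integral_add (integrable_circ (continuous_sliceIntegral hg))
    (integrable_circ (continuous_sliceIntegral hg'))]
  refine integral_congr_ae (.of_forall fun φ => ?_)
  exact intervalIntegral.integral_add ((continuous_slice hg φ).intervalIntegrable _ _)
    ((continuous_slice hg' φ).intervalIntegrable _ _)

lemma cylInt_const_mul (c : ℝ) (g : Cyl → ℝ) : cylInt (fun z => c * g z) = c * cylInt g := by
  unfold cylInt
  rw [← integral_const_mul]
  refine integral_congr_ae (.of_forall fun φ => ?_)
  exact intervalIntegral.integral_const_mul c _

lemma cylInt_const (c : ℝ) : cylInt (fun _ => c) = c := by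
  simp [cylInt, slice, Measure.real, AddCircle.measure_univ]

end Integral

/-! ### Partial derivatives on the cylinder -/

section Calculus

variable {F : Type*} [NormedAddCommGroup F] [NormedSpace ℝ F]

lemma sub_eq_integral_slice [CompleteSpace F] {w g : Cyl → F} {φ : Circ}
    (hw : ∀ τ : unitInterval, HasDerivWithinAt (slice w φ) (g (φ, τ)) (Icc 0 1) (τ : ℝ))
    (hg : Continuous (slice g φ)) (τ : unitInterval) :
    w (φ, τ) - w (φ, 0) = ∫ t in (0 : ℝ)..τ, slice g φ t := by
  have hd : ∀ t ∈ Icc (0 : ℝ) 1, HasDerivWithinAt (slice w φ) (slice g φ t) (Icc 0 1) t := by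
    intro t ht
    rw [slice_of_mem g φ ht]
    exact hw ⟨t, ht⟩
  have hc : ContinuousOn (slice w φ) (Icc 0 1) := fun t ht => (hd t ht).continuousWithinAt
  rw [intervalIntegral.integral_eq_sub_of_hasDerivAt_of_le τ.2.1
    (hc.mono (Icc_subset_Icc_right τ.2.2)) (f' := slice g φ) _ (hg.intervalIntegrable _ _)]
  · rw [slice_coe]
    congr 1
    exact (slice_coe w φ 0).symm
  · intro t ht
    have ht' : t ∈ Ioo (0 : ℝ) 1 := ⟨ht.1, ht.2.trans_le τ.2.2⟩
    exact (hd t (Ioo_subset_Icc_self ht')).hasDerivAt (Icc_mem_nhds ht'.1 ht'.2)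

/-- Ties `dPhi` to the Fréchet derivative of the lift to `ℝ × [0,1]`. At `τ = 0, 1` this is only a
derivative within the strip, which suffices because the horizontal line stays inside it. -/
lemma hasDerivAt_add_coe {w : Cyl → F} (hw : IsC1 w) (x : ℝ) (τ : unitInterval) :
    HasDerivAt (fun s : ℝ => w ((x : Circ) + (s : Circ), τ))
      (fderivWithin ℝ (fun x : ℝ × ℝ => slice w (x.1 : Circ) x.2) (univ ×ˢ Icc (0 : ℝ) 1)
        (x, τ) (1, 0)) 0 := by
  have h1 : HasFDerivWithinAt (fun x : ℝ × ℝ => slice w (x.1 : Circ) x.2)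
      (fderivWithin ℝ (fun x : ℝ × ℝ => slice w (x.1 : Circ) x.2) (univ ×ˢ Icc (0 : ℝ) 1)
        (x, τ)) (univ ×ˢ Icc (0 : ℝ) 1) (x + 0, (τ : ℝ)) := by
    rw [add_zero]
    exact ((hw.differentiableOn one_ne_zero) (x, τ) ⟨mem_univ _, τ.2⟩).hasFDerivWithinAt
  have h2 : HasDerivWithinAt (fun s : ℝ => (x + s, (τ : ℝ))) ((1 : ℝ), (0 : ℝ)) univ 0 :=
    (((hasDerivAt_id (0 : ℝ)).const_add x).prodMk (hasDerivAt_const _ _)).hasDerivWithinAt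
  have hmaps : MapsTo (fun s : ℝ => (x + s, (τ : ℝ))) univ (univ ×ˢ Icc (0 : ℝ) 1) :=
    fun s _ => ⟨mem_univ _, τ.2⟩
  have h3 := (h1.comp_hasDerivWithinAt (0 : ℝ) h2 hmaps).hasDerivAt Filter.univ_mem
  refine h3.congr_of_eventuallyEq (.of_forall fun s => ?_)
  simp

lemma hasDerivAt_dPhi {w : Cyl → F} (hw : IsC1 w) (φ : Circ) (τ : unitInterval) (s : ℝ) :
    HasDerivAt (fun s : ℝ => w (φ + (s : Circ), τ)) (dPhi w (φ + (s : Circ), τ)) s := by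
  obtain ⟨x, rfl⟩ := QuotientAddGroup.mk_surjective φ
  -- The base point `0` is written as `s - s` so that `comp_sub_const` moves it to `s`.
  have h : HasDerivAt (fun r : ℝ => w (((x + s : ℝ) : Circ) + (r : Circ), τ))
      (dPhi w (((x + s : ℝ) : Circ), τ)) (s - s) := by
    rw [sub_self]
    exact (hasDerivAt_add_coe hw (x + s) τ).differentiableAt.hasDerivAt
  have h' := h.comp_sub_const s s
  refine h'.congr_of_eventuallyEq (.of_forall fun r => ?_)
  change w ((x : Circ) + (r : Circ), τ) = w (((x + s : ℝ) : Circ) + ((r - s : ℝ) : Circ), τ)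
  rw [← AddCircle.coe_add, ← AddCircle.coe_add]
  congr 3
  ring

/-- Continuity holds for the lift to `ℝ × [0,1]` and descends along the open quotient map to the
cylinder. -/
lemma continuous_dPhi {w : Cyl → F} (hw : IsC1 w) : Continuous (dPhi w) := by
  have hq : IsOpenQuotientMap (Prod.map ((↑) : ℝ → Circ) (id : unitInterval → unitInterval)) :=
    QuotientAddGroup.isOpenQuotientMap_mk.prodMap IsOpenQuotientMap.id
  refine hq.isQuotientMap.continuous_iff.2 ?_
  have hu : UniqueDiffOn ℝ (univ ×ˢ Icc (0 : ℝ) 1 : Set (ℝ × ℝ)) :=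
    uniqueDiffOn_univ.prod (uniqueDiffOn_Icc zero_lt_one)
  have hc := (hw.continuousOn_fderivWithin hu le_rfl).clm_apply
    (continuousOn_const (c := ((1 : ℝ), (0 : ℝ))))
  have hc' := hc.comp_continuous (f := fun z : ℝ × unitInterval => (z.1, (z.2 : ℝ)))
    (by fun_prop) (fun z => ⟨mem_univ _, z.2.2⟩)
  exact hc'.congr fun z => (hasDerivAt_add_coe hw z.1 z.2).deriv.symm

end Calculus

/-! ### The tangent fields solve the variational equation -/

section Field

variable {n m : ℕ} {f : Vec n → Vec m → Vec n}

lemma contDiff_partial_left (hf : ContDiff ℝ 1 fun x : Vec n × Vec m => f x.1 x.2) (p : Vec m) :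
    ContDiff ℝ 1 fun y => f y p :=
  hf.comp (contDiff_id.prodMk contDiff_const)

lemma hasFDerivAt_dfx (hf : ContDiff ℝ 1 fun x : Vec n × Vec m => f x.1 x.2) (x : Vec n)
    (p : Vec m) : HasFDerivAt (fun y => f y p) (dfx f x p) x :=
  ((contDiff_partial_left hf p).differentiable one_ne_zero x).hasFDerivAt

lemma continuous_dfx (hf : ContDiff ℝ 1 fun x : Vec n × Vec m => f x.1 x.2) (p : Vec m) :
    Continuous fun x => dfx f x p :=
  (contDiff_partial_left hf p).continuous_fderiv one_ne_zero

lemma continuous_dfp (hf : ContDiff ℝ 1 fun x : Vec n × Vec m => f x.1 x.2) (p : Vec m) :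
    Continuous fun x => dfp f x p := by
  have h : ∀ x, dfp f x p = (fderiv ℝ (fun x : Vec n × Vec m => f x.1 x.2) (x, p)).comp
      (ContinuousLinearMap.inr ℝ (Vec n) (Vec m)) := fun x =>
    (((hf.differentiable one_ne_zero (x, p)).hasFDerivAt).comp p
      (hasFDerivAt_prodMk_right x p)).fderiv
  simp only [h]
  exact ((hf.continuous_fderiv one_ne_zero).comp (Continuous.prodMk_left p)).clm_comp
    continuous_const

/-- The coefficient `T ∂_x f(v,p)` of the variational equation. -/
def jac (f : Vec n → Vec m → Vec n) (p : Vec m) (T : ℝ) (v : C(Cyl, Vec n)) (z : Cyl) :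
    Vec n →L[ℝ] Vec n :=
  T • dfx f (v z) p

lemma continuous_jac (hf : ContDiff ℝ 1 fun x : Vec n × Vec m => f x.1 x.2) (p : Vec m) (T : ℝ)
    (v : C(Cyl, Vec n)) : Continuous (jac f p T v) :=
  ((continuous_dfx hf p).comp v.continuous).const_smul T

variable {p : Vec m} {T ρ : ℝ} {v : C(Cyl, Vec n)}

lemma IsTorusSolution.dTau_eq (hv : IsTorusSolution f p T ρ v) (z : Cyl) :
    dTau v z = T • f (v z) p :=
  dTau_eq_of_hasDerivWithinAt (hv.ode z.1 z.2)

lemma IsTorusSolution.continuous_dTau (hv : IsTorusSolution f p T ρ v)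
    (hf : ContDiff ℝ 1 fun x : Vec n × Vec m => f x.1 x.2) : Continuous (dTau v) := by
  have h : Continuous fun z => T • f (v z) p :=
    ((contDiff_partial_left hf p).continuous.comp v.continuous).const_smul T
  exact h.congr fun z => (hv.dTau_eq z).symm

lemma IsTorusSolution.dTau_one (hv : IsTorusSolution f p T ρ v) (φ : Circ) :
    dTau v (φ, 1) = dTau v (φ + (ρ : Circ), 0) := by
  rw [hv.dTau_eq, hv.dTau_eq, hv.bc]

lemma IsTorusSolution.dPhi_one (hv : IsTorusSolution f p T ρ v) (φ : Circ) :
    dPhi v (φ, 1) = dPhi v (φ + (ρ : Circ), 0) := by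
  unfold dPhi
  congr 1
  funext s
  simp only [hv.bc]
  rw [add_right_comm]

lemma IsTorusSolution.dTau_ode (hv : IsTorusSolution f p T ρ v)
    (hf : ContDiff ℝ 1 fun x : Vec n × Vec m => f x.1 x.2) (φ : Circ) (τ : unitInterval) :
    HasDerivWithinAt (slice (dTau v) φ) (jac f p T v (φ, τ) (dTau v (φ, τ))) (Icc 0 1)
      (τ : ℝ) := by
  have h1 : HasFDerivAt (fun y => f y p) (dfx f (v (φ, τ)) p) (slice v φ (τ : ℝ)) := by
    rw [slice_coe]
    exact hasFDerivAt_dfx hf _ p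
  have h2 := (h1.comp_hasDerivWithinAt (τ : ℝ) (hv.ode φ τ)).const_smul T
  rw [hv.dTau_eq (φ, τ)]
  exact h2.congr_of_mem (fun t _ => hv.dTau_eq _) τ.2

/-- Differentiating the integral equation for `v` with respect to `φ`. -/
lemma IsTorusSolution.dPhi_eq_integral (hv : IsTorusSolution f p T ρ v)
    (hf : ContDiff ℝ 1 fun x : Vec n × Vec m => f x.1 x.2) (φ : Circ) (τ : unitInterval) :
    dPhi v (φ, τ) = dPhi v (φ, 0) +
      ∫ t in (0 : ℝ)..τ, slice (fun z => jac f p T v z (dPhi v z)) φ t := by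
  have hG : Continuous fun z => T • f (v z) p :=
    ((contDiff_partial_left hf p).continuous.comp v.continuous).const_smul T
  have hG' : Continuous fun z => jac f p T v z (dPhi v z) :=
    (continuous_jac hf p T v).clm_apply (continuous_dPhi hv.c1)
  obtain ⟨K, hK⟩ := isCompact_univ.exists_bound_of_continuousOn hG'.continuousOn
  have hint : HasDerivAt
      (fun s : ℝ => ∫ t in (0 : ℝ)..τ, slice (fun z => T • f (v z) p) (φ + (s : Circ)) t)
      (∫ t in (0 : ℝ)..τ, slice (fun z => jac f p T v z (dPhi v z)) (φ + ((0 : ℝ) : Circ)) t)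
      0 := by
    refine (intervalIntegral.hasDerivAt_integral_of_dominated_loc_of_deriv_le
      (F := fun (s : ℝ) t => slice (fun z => T • f (v z) p) (φ + (s : Circ)) t)
      (F' := fun (s : ℝ) t => slice (fun z => jac f p T v z (dPhi v z)) (φ + (s : Circ)) t)
      (bound := fun _ => K) Filter.univ_mem
      (.of_forall fun s => (continuous_slice hG _).aestronglyMeasurable)
      ((continuous_slice hG _).intervalIntegrable _ _)
      (continuous_slice hG' _).aestronglyMeasurable
      (.of_forall fun t _ s _ => hK _ (mem_univ _))
      intervalIntegrable_const (.of_forall fun t _ s _ => ?_)).2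
    exact ((hasFDerivAt_dfx hf _ p).comp_hasDerivAt s
      (hasDerivAt_dPhi hv.c1 φ (projIcc (0 : ℝ) 1 zero_le_one t) s)).const_smul T
  have hsum := (hasDerivAt_dPhi hv.c1 φ 0 0).add hint
  have hτ := hasDerivAt_dPhi hv.c1 φ τ 0
  have hcongr : (fun s : ℝ => v (φ + (s : Circ), τ)) = fun s : ℝ => v (φ + (s : Circ), 0) +
      ∫ t in (0 : ℝ)..τ, slice (fun z => T • f (v z) p) (φ + (s : Circ)) t := by
    funext s
    rw [← sub_eq_integral_slice (g := fun z => T • f (v z) p) (hv.ode _)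
      (continuous_slice hG _) τ]
    abel
  rw [hcongr] at hτ
  simpa using hτ.unique hsum

/-- Since `v` is only `C¹`, mixed second derivatives cannot simply be interchanged; the equation
comes from the integral identity and the fundamental theorem of calculus. -/
lemma IsTorusSolution.dPhi_ode (hv : IsTorusSolution f p T ρ v)
    (hf : ContDiff ℝ 1 fun x : Vec n × Vec m => f x.1 x.2) (φ : Circ) (τ : unitInterval) :
    HasDerivWithinAt (slice (dPhi v) φ) (jac f p T v (φ, τ) (dPhi v (φ, τ))) (Icc 0 1)
      (τ : ℝ) := by
  have hG' : Continuous (slice (fun z => jac f p T v z (dPhi v z)) φ) :=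
    continuous_slice ((continuous_jac hf p T v).clm_apply (continuous_dPhi hv.c1)) φ
  have h := ((hG'.integral_hasStrictDerivAt 0 (τ : ℝ)).hasDerivAt.const_add
    (dPhi v (φ, 0))).hasDerivWithinAt (s := Icc 0 1)
  rw [slice_coe] at h
  refine h.congr_of_mem (fun t ht => ?_) τ.2
  rw [slice_of_mem _ φ ht, hv.dPhi_eq_integral hf φ ⟨t, ht⟩]

end Field

/-! ### Linear independence of the tangent vectors -/

section Tangent

variable {n m : ℕ} {f : Vec n → Vec m → Vec n} {p : Vec m} {T ρ : ℝ} {v : C(Cyl, Vec n)}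

lemma cylInt_inner_combination {κ u w : Cyl → Vec n} (hκ : Continuous κ) (hu : Continuous u)
    (hw : Continuous w) (c d : ℝ) :
    cylInt (fun z => ⟪κ z, c • u z + d • w z⟫) =
      cylInt (fun z => ⟪κ z, u z⟫) * c + cylInt (fun z => ⟪κ z, w z⟫) * d := by
  simp only [inner_add_right, inner_smul_right]
  rw [cylInt_add (by fun_prop) (by fun_prop), cylInt_const_mul, cylInt_const_mul]
  ring

/-- The phase conditions force the tangent vectors to be independent at every point. -/
lemma IsTorusSolution.tangent_independent (hv : IsTorusSolution f p T ρ v)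
    (hf : ContDiff ℝ 1 fun x : Vec n × Vec m => f x.1 x.2) (hρ : Irrational ρ)
    {k : Fin 2 → C(Cyl, Vec n)} (hdet : (phaseMatrix k v).det ≠ 0) (z : Cyl) (c d : ℝ)
    (hz : c • dTau v z + d • dPhi v z = 0) : c = 0 ∧ d = 0 := by
  set w : Cyl → Vec n := fun z => c • dTau v z + d • dPhi v z with hw
  have hτc := hv.continuous_dTau hf
  have hφc := continuous_dPhi hv.c1
  have hwc : Continuous w := by fun_prop
  have hode : ∀ φ (τ : unitInterval),
      HasDerivWithinAt (slice w φ) (jac f p T v (φ, τ) (w (φ, τ))) (Icc 0 1) (τ : ℝ) := by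
    intro φ τ
    have := ((hv.dTau_ode hf φ τ).const_smul c).add ((hv.dPhi_ode hf φ τ).const_smul d)
    rw [hw, map_add, map_smul, map_smul]
    exact this
  have hprop : ∀ φ (τ₀ τ : unitInterval), w (φ, τ₀) = 0 → w (φ, τ) = 0 := fun φ τ₀ τ h0 =>
    eq_zero_of_linear_ode (continuous_jac hf p T v) (hode φ) h0 τ
  have hshift : ∀ φ, w (φ, 1) = w (φ + (ρ : Circ), 0) := fun φ => by
    simp only [hw, hv.dTau_one, hv.dPhi_one]
  -- A zero of `w` spreads along its slice and, through `hshift`, to the slices over `φ ± ρ`. The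
  -- zero set at `τ = 0` is therefore closed and rotation invariant, so `w` vanishes identically and
  -- `(c, d)` lies in the kernel of the phase matrix.
  have huniv := eq_univ_of_rotation_invariant hρ (S := {φ | w (φ, 0) = 0})
    (isClosed_singleton.preimage (hwc.comp (Continuous.prodMk_left 0)))
    (fun φ => ⟨fun h => (hshift φ).symm.trans (hprop φ 0 1 h),
      fun h => hprop φ 1 0 ((hshift φ).trans h)⟩)
    (φ₀ := z.1) (hprop z.1 z.2 0 hz)
  have hw0 : ∀ z, w z = 0 := fun z =>
    hprop z.1 0 z.2 (huniv ▸ mem_univ z.1 : z.1 ∈ {φ | w (φ, 0) = 0})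
  have hmul : (phaseMatrix k v).mulVec ![c, d] = 0 := by
    funext i
    have := cylInt_inner_combination (k i).continuous hτc hφc c d
    have h0 : cylInt (fun z => ⟪k i z, c • dTau v z + d • dPhi v z⟫) = 0 := by
      have : (fun z => ⟪k i z, c • dTau v z + d • dPhi v z⟫) = fun _ => (0 : ℝ) := by
        funext z
        rw [show c • dTau v z + d • dPhi v z = 0 from hw0 z, inner_zero_right]
      rw [this, cylInt_const]
    rw [h0] at this
    simp [phaseMatrix, Matrix.mulVec, dotProduct, Fin.sum_univ_two, ← this]
  have h0 := Matrix.eq_zero_of_mulVec_eq_zero hdet hmul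
  exact ⟨congrFun h0 0, congrFun h0 1⟩

/-- The tangent vectors `∂_τ v`, `∂_φ v` are linearly independent at every point. -/
def TangentIndependent (v : C(Cyl, Vec n)) : Prop :=
  ∀ (z : Cyl) (c d : ℝ), c • dTau v z + d • dPhi v z = 0 → c = 0 ∧ d = 0

lemma TangentIndependent.coeff_eq (hli : TangentIndependent v) (z : Cyl) {c d c' d' : ℝ}
    (h : c • dTau v z + d • dPhi v z = c' • dTau v z + d' • dPhi v z) : c = c' ∧ d = d' := by
  have := hli z (c - c') (d - d') (by
    rw [sub_smul, sub_smul, ← sub_eq_zero.2 h]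
    abel)
  exact ⟨sub_eq_zero.1 this.1, sub_eq_zero.1 this.2⟩

/-- The second vector is `‖b‖²` times the component of `a` orthogonal to `b`. It serves to isolate
`q_τ` and `q_φ` in the transpose of `q_tg`. -/
lemma inner_smul_sub_smul_eq_zero (a b : Vec n) : ⟪b, ⟪b, b⟫ • a - ⟪a, b⟫ • b⟫ = 0 := by
  rw [inner_sub_right, inner_smul_right, inner_smul_right, real_inner_comm a b]
  ring

lemma inner_smul_sub_smul_ne_zero {a b : Vec n}
    (h : ∀ c d : ℝ, c • a + d • b = 0 → c = 0 ∧ d = 0) :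
    ⟪a, ⟪b, b⟫ • a - ⟪a, b⟫ • b⟫ ≠ 0 := by
  intro h0
  have hu : ⟪b, b⟫ • a - ⟪a, b⟫ • b = 0 := by
    rw [← inner_self_eq_zero (𝕜 := ℝ)]
    nth_rw 1 [inner_sub_left]
    rw [inner_smul_left, inner_smul_left, h0, inner_smul_sub_smul_eq_zero]
    simp
  have h1 := (h ⟪b, b⟫ (-⟪a, b⟫) (by rw [neg_smul, ← sub_eq_add_neg, hu])).1
  have h2 := h 0 1 (by rw [inner_self_eq_zero.1 h1]; simp)
  exact one_ne_zero h2.2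

end Tangent

/-! ### The propagator `V` and its adjoint equation -/

section Variational

variable {n m : ℕ} {f : Vec n → Vec m → Vec n} {p : Vec m} {T ρ : ℝ} {v : C(Cyl, Vec n)}
  {V : Cyl → Vec n →L[ℝ] Vec n}

lemma IsVariational.apply_ode (hV : IsVariational f p T v V) (u : Vec n) (φ : Circ)
    (τ : unitInterval) :
    HasDerivWithinAt (slice (fun z => V z u) φ) (jac f p T v (φ, τ) (V (φ, τ) u)) (Icc 0 1)
      (τ : ℝ) := by
  have := (hV.ode φ τ).clm_apply (hasDerivWithinAt_const (τ : ℝ) (Icc (0 : ℝ) 1) u)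
  simpa using! this

/-- `V` propagates the initial values of all solutions of the variational equation. -/
lemma IsVariational.apply_initial (hV : IsVariational f p T v V)
    (hf : ContDiff ℝ 1 fun x : Vec n × Vec m => f x.1 x.2) {w : Cyl → Vec n} {φ : Circ}
    (hw : ∀ τ : unitInterval,
      HasDerivWithinAt (slice w φ) (jac f p T v (φ, τ) (w (φ, τ))) (Icc 0 1) (τ : ℝ))
    (τ : unitInterval) : V (φ, τ) (w (φ, 0)) = w (φ, τ) := by
  refine sub_eq_zero.1 (eq_zero_of_linear_ode (continuous_jac hf p T v)
    (w := fun z => V z (w (φ, 0)) - w z) (φ := φ) (fun τ => ?_) (τ₀ := 0) ?_ τ)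
  · rw [map_sub]
    exact (hV.apply_ode (w (φ, 0)) φ τ).sub (hw τ)
  · simp [hV.init]

/-- A vector killed at time `τ` gives a solution that vanishes at time `0` too, where `V` is the
identity; in finite dimension injectivity suffices. -/
lemma IsVariational.isUnit (hV : IsVariational f p T v V)
    (hf : ContDiff ℝ 1 fun x : Vec n × Vec m => f x.1 x.2) (z : Cyl) : IsUnit (V z) := by
  have hinj : Function.Injective (V z) := by
    rw [injective_iff_map_eq_zero]
    intro u hu
    have := eq_zero_of_linear_ode (continuous_jac hf p T v) (w := fun z => V z u) (φ := z.1)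
      (hV.apply_ode u z.1) (τ₀ := z.2) hu 0
    simpa [hV.init] using this
  rw [ContinuousLinearMap.isUnit_iff_bijective]
  exact ⟨hinj, LinearMap.surjective_of_injective (f := (V z).toLinearMap) hinj⟩

lemma IsVariational.surjective (hV : IsVariational f p T v V)
    (hf : ContDiff ℝ 1 fun x : Vec n × Vec m => f x.1 x.2) (z : Cyl) :
    Function.Surjective (V z) :=
  (ContinuousLinearMap.isUnit_iff_bijective.1 (hV.isUnit hf z)).2

lemma hasDerivWithinAt_of_inner {u : ℝ → Vec n} {u' : Vec n} {s : Set ℝ} {t : ℝ}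
    (h : ∀ w : Vec n, HasDerivWithinAt (fun t => ⟪u t, w⟫) ⟪u', w⟫ s t) :
    HasDerivWithinAt u u' s t := by
  have e := EuclideanSpace.basisFun (Fin n) ℝ
  have hsum : ∀ x : Vec n, x = ∑ i, ⟪x, e i⟫ • e i := fun x => by
    conv_lhs => rw [← e.sum_repr' x]
    simp only [real_inner_comm]
  rw [hsum u', funext fun t => hsum (u t)]
  exact HasDerivWithinAt.fun_sum fun i _ => (h (e i)).smul_const (e i)

/-- Covectors transported by `V` solve the adjoint variational equation. -/
lemma IsVariational.adjoint_ode (hV : IsVariational f p T v V)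
    (hf : ContDiff ℝ 1 fun x : Vec n × Vec m => f x.1 x.2) {q : Cyl → Vec n} {φ : Circ}
    (hq : ∀ (τ : unitInterval) (u : Vec n), ⟪q (φ, τ), V (φ, τ) u⟫ = ⟪q (φ, 0), u⟫)
    (τ : unitInterval) :
    HasDerivWithinAt (slice q φ)
      (-(T • ContinuousLinearMap.adjoint (dfx f (v (φ, τ)) p) (q (φ, τ)))) (Icc 0 1) (τ : ℝ) := by
  have hmul : ∀ z, V z * Ring.inverse (V z) = 1 := fun z =>
    Ring.mul_inverse_cancel _ (hV.isUnit hf z)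
  -- No regularity of `q` in `τ` is assumed: it is inherited from `q = V⁻ᵀ q(·,0)` and the
  -- differentiability of operator inversion.
  have hinv : ∀ (τ : unitInterval) (w : Vec n),
      ⟪q (φ, τ), w⟫ = ⟪q (φ, 0), Ring.inverse (V (φ, τ)) w⟫ := fun τ w => by
    rw [← hq τ, ← mul_apply_eq_comp, hmul]
    rfl
  refine hasDerivWithinAt_of_inner fun w => ?_
  obtain ⟨U, hU⟩ := hV.isUnit hf (φ, τ)
  have h1 := hasFDerivAt_ringInverse (𝕜 := ℝ) U
  rw [hU, ← slice_coe V φ τ] at h1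
  have h2 := (h1.comp_hasDerivWithinAt (τ : ℝ) (hV.ode φ τ)).clm_apply
    (hasDerivWithinAt_const (τ : ℝ) (Icc (0 : ℝ) 1) w)
  have h3 := (hasDerivWithinAt_const (τ : ℝ) (Icc (0 : ℝ) 1) (q (φ, 0))).inner ℝ h2
  have h4 : HasDerivWithinAt (fun t => ⟪slice q φ t, w⟫) _ (Icc 0 1) (τ : ℝ) :=
    h3.congr_of_mem (fun t ht => by
      rw [slice_of_mem q φ ht, hinv]
      simp [slice_of_mem V φ ht]) τ.2
  convert! h4 using 1
  have hUinv : (↑U⁻¹ : Vec n →L[ℝ] Vec n) = Ring.inverse (V (φ, τ)) := by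
    rw [← hU, Ring.inverse_unit]
  have hVU : ∀ x, V (φ, τ) (Ring.inverse (V (φ, τ)) x) = x := fun x => by
    rw [← mul_apply_eq_comp, hmul]
    rfl
  simp [hUinv, inner_neg_left, inner_smul_left, inner_smul_right,
    ContinuousLinearMap.adjoint_inner_left, hVU, hinv τ]

end Variational

/-! ### The covectors `q_τ`, `q_φ` of the tangential projection -/

section Projection

variable {n m : ℕ} {f : Vec n → Vec m → Vec n} {p : Vec m} {T ρ : ℝ} {v : C(Cyl, Vec n)}
  {V : Cyl → Vec n →L[ℝ] Vec n} {qτ qφ : Cyl → Vec n}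

lemma qtg_apply (v : C(Cyl, Vec n)) (qτ qφ : Cyl → Vec n) (z : Cyl) (u : Vec n) :
    qtg v qτ qφ z u = ⟪qτ z, u⟫ • dTau v z + ⟪qφ z, u⟫ • dPhi v z := by
  simp [qtg]

lemma IsNormallyHyperbolic.qtg_apply_of_mem (hnh : IsNormallyHyperbolic ρ v V qτ qφ) {z : Cyl}
    {u : Vec n} (hu : u ∈ Submodule.span ℝ {dTau v z, dPhi v z}) : qtg v qτ qφ z u = u := by
  rw [← hnh.range_eq z] at hu
  obtain ⟨y, rfl⟩ := hu
  exact congrArg (fun L : Vec n →L[ℝ] Vec n => L y) (hnh.idem z)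

/-- The projection fixes its range, so coefficients can be compared by independence. With
`inner_dPhi` this makes `q_τ`, `q_φ` dual to the tangent vectors. -/
lemma IsNormallyHyperbolic.inner_dTau (hnh : IsNormallyHyperbolic ρ v V qτ qφ)
    (hli : TangentIndependent v) (z : Cyl) : ⟪qτ z, dTau v z⟫ = 1 ∧ ⟪qφ z, dTau v z⟫ = 0 := by
  have h := hnh.qtg_apply_of_mem (z := z) (Submodule.subset_span (mem_insert _ _))
  rw [qtg_apply] at h
  exact hli.coeff_eq z (by rw [h]; simp)

lemma IsNormallyHyperbolic.inner_dPhi (hnh : IsNormallyHyperbolic ρ v V qτ qφ)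
    (hli : TangentIndependent v) (z : Cyl) : ⟪qτ z, dPhi v z⟫ = 0 ∧ ⟪qφ z, dPhi v z⟫ = 1 := by
  have h := hnh.qtg_apply_of_mem (z := z)
    (Submodule.subset_span (mem_insert_of_mem _ (mem_singleton _)))
  rw [qtg_apply] at h
  exact hli.coeff_eq z (by rw [h]; simp)

lemma IsNormallyHyperbolic.q_one (hnh : IsNormallyHyperbolic ρ v V qτ qφ)
    (hli : TangentIndependent v) (hv : IsTorusSolution f p T ρ v) (φ : Circ) :
    qτ (φ, 1) = qτ (φ + (ρ : Circ), 0) ∧ qφ (φ, 1) = qφ (φ + (ρ : Circ), 0) := by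
  have h : ∀ u, ⟪qτ (φ, 1), u⟫ = ⟪qτ (φ + (ρ : Circ), 0), u⟫ ∧
      ⟪qφ (φ, 1), u⟫ = ⟪qφ (φ + (ρ : Circ), 0), u⟫ := fun u => by
    have := congrArg (fun L : Vec n →L[ℝ] Vec n => L u) (hnh.shift φ)
    simp only [qtg_apply, ← hv.dTau_one, ← hv.dPhi_one] at this
    exact hli.coeff_eq _ this
  exact ⟨ext_inner_right ℝ fun u => (h u).1, ext_inner_right ℝ fun u => (h u).2⟩

/-- `V` carries tangent vectors at `(φ, 0)` to those at `(φ, τ)`, so the invariance of `q_tg` splits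
into one identity per coefficient. This is the input of `adjoint_ode`. -/
lemma IsNormallyHyperbolic.q_transport (hnh : IsNormallyHyperbolic ρ v V qτ qφ)
    (hli : TangentIndependent v) (hv : IsTorusSolution f p T ρ v) (hV : IsVariational f p T v V)
    (hf : ContDiff ℝ 1 fun x : Vec n × Vec m => f x.1 x.2) (φ : Circ) (τ : unitInterval)
    (u : Vec n) :
    ⟪qτ (φ, τ), V (φ, τ) u⟫ = ⟪qτ (φ, 0), u⟫ ∧ ⟪qφ (φ, τ), V (φ, τ) u⟫ = ⟪qφ (φ, 0), u⟫ := by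
  have h := congrArg (fun L : Vec n →L[ℝ] Vec n => L u) (hnh.invariant φ τ)
  simp only [ContinuousLinearMap.comp_apply, qtg_apply, map_add, map_smul,
    hV.apply_initial hf (hv.dTau_ode hf φ), hV.apply_initial hf (hv.dPhi_ode hf φ)] at h
  exact hli.coeff_eq _ h

/-- The combination is the transpose of `q_tg` applied to `y`. -/
lemma IsNormallyHyperbolic.continuous_combination (hnh : IsNormallyHyperbolic ρ v V qτ qφ)
    {y : Cyl → Vec n} (hy : Continuous y) :
    Continuous fun z => ⟪dTau v z, y z⟫ • qτ z + ⟪dPhi v z, y z⟫ • qφ z := by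
  have h := ((ContinuousLinearMap.adjoint (𝕜 := ℝ) (E := Vec n) (F := Vec n)).continuous.comp
    hnh.cont).clm_apply hy
  refine h.congr fun z => ext_inner_right ℝ fun u => ?_
  simp only [Function.comp_apply, ContinuousLinearMap.adjoint_inner_left, qtg_apply,
    inner_add_left, inner_add_right, inner_smul_left, inner_smul_right, real_inner_comm (y z),
    RCLike.conj_to_real]
  ring

/-- Only `q_tg` is assumed continuous. Applying its transpose to a vector orthogonal to one tangent
vector but not to the other leaves a nonzero continuous multiple of a single covector. -/
lemma IsNormallyHyperbolic.continuous_q (hnh : IsNormallyHyperbolic ρ v V qτ qφ)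
    (hli : TangentIndependent v) (hτ : Continuous (dTau v)) (hφ : Continuous (dPhi v)) :
    Continuous qτ ∧ Continuous qφ := by
  have h1 : ∀ z, ⟪dTau v z,
      ⟪dPhi v z, dPhi v z⟫ • dTau v z - ⟪dTau v z, dPhi v z⟫ • dPhi v z⟫ ≠ 0 :=
    fun z => inner_smul_sub_smul_ne_zero (hli z)
  have h2 : ∀ z, ⟪dPhi v z,
      ⟪dTau v z, dTau v z⟫ • dPhi v z - ⟪dPhi v z, dTau v z⟫ • dTau v z⟫ ≠ 0 :=
    fun z => inner_smul_sub_smul_ne_zero fun c d h => (hli z d c (by rwa [add_comm])).symm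
  constructor
  · have hd : Continuous fun z => ⟪dTau v z,
        ⟪dPhi v z, dPhi v z⟫ • dTau v z - ⟪dTau v z, dPhi v z⟫ • dPhi v z⟫ := by fun_prop
    have h := hnh.continuous_combination (y := fun z =>
      ⟪dPhi v z, dPhi v z⟫ • dTau v z - ⟪dTau v z, dPhi v z⟫ • dPhi v z) (by fun_prop)
    refine ((hd.inv₀ h1).smul h).congr fun z => ?_
    simp only [Pi.smul_apply', Pi.inv_apply, inner_smul_sub_smul_eq_zero, zero_smul, add_zero]
    rw [smul_smul, inv_mul_cancel₀ (h1 z), one_smul]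
  · have hd : Continuous fun z => ⟪dPhi v z,
        ⟪dTau v z, dTau v z⟫ • dPhi v z - ⟪dPhi v z, dTau v z⟫ • dTau v z⟫ := by fun_prop
    have h := hnh.continuous_combination (y := fun z =>
      ⟪dTau v z, dTau v z⟫ • dPhi v z - ⟪dPhi v z, dTau v z⟫ • dTau v z) (by fun_prop)
    refine ((hd.inv₀ h2).smul h).congr fun z => ?_
    simp only [Pi.smul_apply', Pi.inv_apply, inner_smul_sub_smul_eq_zero, zero_smul, zero_add]
    rw [smul_smul, inv_mul_cancel₀ (h2 z), one_smul]

end Projection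

/-! ### Solutions of the adjoint conditions -/

section Adjoint

variable {n m : ℕ} {f : Vec n → Vec m → Vec n} {p : Vec m} {T ρ : ℝ} {v : C(Cyl, Vec n)}
  {V : Cyl → Vec n →L[ℝ] Vec n} {qτ qφ : Cyl → Vec n} {k : Fin 2 → C(Cyl, Vec n)}
  {kp : Fin 2 → Vec m →L[ℝ] ℝ} {ηT ηρ : ℝ} {X : AdjointVars n m}

/-- Pairing of the adjoint equation with a solution of the variational equation. -/
lemma IsAdjointSolution.hasDerivWithinAt_inner (hX : IsAdjointSolution f p T ρ v k kp ηT ηρ X)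
    {w : Cyl → Vec n} {φ : Circ}
    (hw : ∀ τ : unitInterval,
      HasDerivWithinAt (slice w φ) (jac f p T v (φ, τ) (w (φ, τ))) (Icc 0 1) (τ : ℝ))
    (τ : unitInterval) :
    HasDerivWithinAt (slice (fun z => ⟪X.de z, w z⟫) φ)
      ⟪∑ i, X.ps i • k i (φ, τ), w (φ, τ)⟫ (Icc 0 1) (τ : ℝ) := by
  have h := (hX.var_v φ τ).inner ℝ (hw τ)
  simp only [slice_coe] at h
  convert! h using 1
  rw [inner_add_left, inner_neg_left, inner_smul_left, ContinuousLinearMap.adjoint_inner_left,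
    jac, smul_apply, inner_smul_right]
  simp

lemma IsAdjointSolution.bc_eq (hX : IsAdjointSolution f p T ρ v k kp ηT ηρ X) (φ : Circ) :
    X.de (φ, 1) = X.bc φ :=
  sub_eq_zero.1 (hX.var_v1 φ).symm

lemma IsAdjointSolution.de_zero (hX : IsAdjointSolution f p T ρ v k kp ηT ηρ X) (φ : Circ) :
    X.de (φ, 0) = X.bc (φ - (ρ : Circ)) := by
  have := hX.var_v0 φ
  rw [eq_comm, neg_add_eq_zero] at this
  exact this

/-- Integrating the pairing in `τ` leaves `g(φ) - g(φ - ρ)`, whose integral over the circle is zero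
by translation invariance. -/
lemma IsAdjointSolution.cylInt_phase_eq_zero (hX : IsAdjointSolution f p T ρ v k kp ηT ηρ X)
    (hbc : Continuous X.bc) {w : Cyl → Vec n} (hwc : Continuous w)
    (hw : ∀ φ (τ : unitInterval),
      HasDerivWithinAt (slice w φ) (jac f p T v (φ, τ) (w (φ, τ))) (Icc 0 1) (τ : ℝ))
    (hshift : ∀ φ, w (φ, 1) = w (φ + (ρ : Circ), 0)) :
    cylInt (fun z => ⟪∑ i, X.ps i • k i z, w z⟫) = 0 := by
  set g : Circ → ℝ := fun φ => ⟪X.bc φ, w (φ + (ρ : Circ), 0)⟫ with hg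
  have hgc : Continuous g := by fun_prop
  have hκ : Continuous fun z => ⟪∑ i, X.ps i • k i z, w z⟫ := by fun_prop
  have hinner : ∀ φ : Circ, ∫ s in (0 : ℝ)..1, slice (fun z => ⟪∑ i, X.ps i • k i z, w z⟫) φ s =
      g φ - g (φ - (ρ : Circ)) := by
    intro φ
    have := sub_eq_integral_slice (w := fun z => ⟪X.de z, w z⟫)
      (g := fun z => ⟪∑ i, X.ps i • k i z, w z⟫)
      (fun τ => hX.hasDerivWithinAt_inner (hw φ) τ) (continuous_slice hκ φ) 1
    rw [Icc.coe_one] at this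
    rw [← this, hX.bc_eq, hX.de_zero, hshift]
    simp [hg]
  unfold cylInt
  simp only [hinner]
  rw [integral_sub (integrable_circ hgc) (integrable_circ (by fun_prop)),
    integral_sub_right_eq_self, sub_self]

lemma IsAdjointSolution.ps_eq_zero (hX : IsAdjointSolution f p T ρ v k kp ηT ηρ X)
    (hbc : Continuous X.bc) (hv : IsTorusSolution f p T ρ v)
    (hf : ContDiff ℝ 1 fun x : Vec n × Vec m => f x.1 x.2)
    (hdet : (phaseMatrix k v).det ≠ 0) : X.ps = 0 := by
  have hsum : ∀ {w : Cyl → Vec n}, Continuous w →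
      cylInt (fun z => ⟪∑ i, X.ps i • k i z, w z⟫) =
        X.ps 0 * cylInt (fun z => ⟪k 0 z, w z⟫) + X.ps 1 * cylInt (fun z => ⟪k 1 z, w z⟫) := by
    intro w hw
    simp only [Fin.sum_univ_two, inner_add_left, inner_smul_left, RCLike.conj_to_real]
    rw [cylInt_add (by fun_prop) (by fun_prop), cylInt_const_mul, cylInt_const_mul]
  have hτ := hX.cylInt_phase_eq_zero hbc (hv.continuous_dTau hf) (hv.dTau_ode hf) hv.dTau_one
  have hφ := hX.cylInt_phase_eq_zero hbc (continuous_dPhi hv.c1) (hv.dPhi_ode hf) hv.dPhi_one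
  rw [hsum (hv.continuous_dTau hf)] at hτ
  rw [hsum (continuous_dPhi hv.c1)] at hφ
  refine Matrix.eq_zero_of_vecMul_eq_zero hdet ?_
  funext j
  fin_cases j
  · simpa [phaseMatrix, Matrix.vecMul, dotProduct, Fin.sum_univ_two] using hτ
  · simpa [phaseMatrix, Matrix.vecMul, dotProduct, Fin.sum_univ_two] using hφ

lemma IsAdjointSolution.inner_eq_initial (hX : IsAdjointSolution f p T ρ v k kp ηT ηρ X)
    (hps : X.ps = 0) {w : Cyl → Vec n} {φ : Circ}
    (hw : ∀ τ : unitInterval,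
      HasDerivWithinAt (slice w φ) (jac f p T v (φ, τ) (w (φ, τ))) (Icc 0 1) (τ : ℝ))
    (τ : unitInterval) : ⟪X.de (φ, τ), w (φ, τ)⟫ = ⟪X.de (φ, 0), w (φ, 0)⟫ := by
  have := sub_eq_integral_slice (w := fun z => ⟪X.de z, w z⟫) (g := fun _ => (0 : ℝ)) (φ := φ)
    (fun τ => by simpa [hps] using hX.hasDerivWithinAt_inner hw τ) continuous_const τ
  simpa [slice, sub_eq_zero] using this

/-- The pairing of an adjoint solution with a tangent field is constant on the cylinder. -/
lemma IsAdjointSolution.exists_inner_eq (hX : IsAdjointSolution f p T ρ v k kp ηT ηρ X)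
    (hbc : Continuous X.bc) (hps : X.ps = 0) (hρ : Irrational ρ) {w : Cyl → Vec n}
    (hwc : Continuous w)
    (hw : ∀ φ (τ : unitInterval),
      HasDerivWithinAt (slice w φ) (jac f p T v (φ, τ) (w (φ, τ))) (Icc 0 1) (τ : ℝ))
    (hshift : ∀ φ, w (φ, 1) = w (φ + (ρ : Circ), 0)) :
    ∃ c : ℝ, (∀ z, ⟪X.de z, w z⟫ = c) ∧ ∀ φ, ⟪X.bc φ, w (φ + (ρ : Circ), 0)⟫ = c := by
  have hzero : ∀ φ, ⟪X.bc φ, w (φ + (ρ : Circ), 0)⟫ = ⟪X.de (φ, 0), w (φ, 0)⟫ := fun φ => by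
    rw [← hX.bc_eq, ← hshift, hX.inner_eq_initial hps (hw φ)]
  have hinv : ∀ φ, ⟪X.bc (φ + (ρ : Circ)), w (φ + (ρ : Circ) + (ρ : Circ), 0)⟫ =
      ⟪X.bc φ, w (φ + (ρ : Circ), 0)⟫ := fun φ => by
    rw [hzero, hX.de_zero, add_sub_cancel_right]
  have hconst := const_of_rotation_invariant hρ
    (g := fun φ => ⟪X.bc φ, w (φ + (ρ : Circ), 0)⟫) (by fun_prop) hinv
  refine ⟨⟪X.bc 0, w (0 + (ρ : Circ), 0)⟫, fun z => ?_, fun φ => hconst φ 0⟩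
  rw [← hconst z.1 0, hzero]
  exact hX.inner_eq_initial hps (hw z.1) z.2

/-- Adjoint solutions annihilate the transversal directions. -/
lemma IsAdjointSolution.inner_qtr_eq_zero (hX : IsAdjointSolution f p T ρ v k kp ηT ηρ X)
    (hbc : Continuous X.bc) (hps : X.ps = 0) (hV : IsVariational f p T v V)
    (hnh : IsNormallyHyperbolic ρ v V qτ qφ) (φ : Circ) (u : Vec n) :
    ⟪X.de (φ, 0), qtr v qτ qφ (φ, 0) u⟫ = 0 := by
  set β : Circ → Vec n := fun φ => X.de (φ, 0) with hβ
  have hβc : Continuous β := by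
    have : Continuous fun φ => X.bc (φ - (ρ : Circ)) := by fun_prop
    exact this.congr fun φ => (hX.de_zero φ).symm
  have hqc : Continuous fun φ : Circ => qtr v qτ qφ (φ, 0) :=
    continuous_const.sub (hnh.cont.comp (Continuous.prodMk_left 0))
  have hac : Continuous fun φ => ContinuousLinearMap.adjoint (qtr v qτ qφ (φ, 0)) (β φ) :=
    ((ContinuousLinearMap.adjoint (𝕜 := ℝ) (E := Vec n) (F := Vec n)).continuous.comp
      hqc).clm_apply hβc
  -- The target is chosen so that pairing `β` with `Γδ = q_tr q_trᵀ β` yields `‖q_trᵀ β‖²`.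
  obtain ⟨δ, hδ, hδγ⟩ := hnh.bijOn.surjOn
    (show (fun φ => qtr v qτ qφ (φ, 0) (ContinuousLinearMap.adjoint (qtr v qτ qφ (φ, 0)) (β φ)))
      ∈ transversal v qτ qφ from ⟨_, hac, rfl⟩)
  have hδc : Continuous δ := by
    obtain ⟨δ', hδ', rfl⟩ := hδ
    exact hqc.clm_apply hδ'
  -- The pairing of `λ_de` with the solution starting at `δ(φ - ρ)` is conserved along the slice
  -- over `φ - ρ`, and `λ_de(φ - ρ, 1) = β(φ)`. The right-hand side is thus a difference of rotates
  -- of one function and integrates to zero.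
  have hG : ∀ φ, ‖ContinuousLinearMap.adjoint (qtr v qτ qφ (φ, 0)) (β φ)‖ ^ 2 =
      ⟪β (φ - (ρ : Circ)), δ (φ - (ρ : Circ))⟫ - ⟪β φ, δ φ⟫ := by
    intro φ
    have h1 := congrFun hδγ φ
    have h2 := hX.inner_eq_initial hps (hV.apply_ode (δ (φ - (ρ : Circ))) (φ - (ρ : Circ))) 1
    rw [hV.init, ContinuousLinearMap.id_apply, hX.bc_eq, ← hX.de_zero] at h2
    rw [← real_inner_self_eq_norm_sq, ContinuousLinearMap.adjoint_inner_left, ← h1, Gam,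
      inner_sub_right]
    exact congrArg (· - ⟪β φ, δ φ⟫) h2
  have hint : ∫ φ : Circ, ‖ContinuousLinearMap.adjoint (qtr v qτ qφ (φ, 0)) (β φ)‖ ^ 2 = 0 := by
    have hc : Continuous fun φ => ⟪β φ, δ φ⟫ := by fun_prop
    simp only [hG]
    rw [integral_sub (integrable_circ (by fun_prop)) (integrable_circ hc),
      integral_sub_right_eq_self (fun φ => ⟪β φ, δ φ⟫), sub_self]
  have hsq : Continuous fun φ => ‖ContinuousLinearMap.adjoint (qtr v qτ qφ (φ, 0)) (β φ)‖ ^ 2 :=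
    hac.norm.pow 2
  rw [integral_eq_zero_iff_of_nonneg (fun φ => sq_nonneg _) (integrable_circ hsq),
    Continuous.ae_eq_iff_eq _ hsq continuous_zero] at hint
  have h0 : ContinuousLinearMap.adjoint (qtr v qτ qφ (φ, 0)) (β φ) = 0 := by
    simpa using congrFun hint φ
  change ⟪β φ, _⟫ = 0
  rw [← ContinuousLinearMap.adjoint_inner_left, h0, inner_zero_left]

lemma IsAdjointSolution.de_eq (hX : IsAdjointSolution f p T ρ v k kp ηT ηρ X)
    (hbc : Continuous X.bc) (hps : X.ps = 0) (hρ : Irrational ρ)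
    (hli : TangentIndependent v) (hv : IsTorusSolution f p T ρ v)
    (hf : ContDiff ℝ 1 fun x : Vec n × Vec m => f x.1 x.2) (hV : IsVariational f p T v V)
    (hnh : IsNormallyHyperbolic ρ v V qτ qφ) (z : Cyl) :
    X.de z = (T * ηT) • qτ z - ηρ • qφ z := by
  obtain ⟨c, hc, -⟩ := hX.exists_inner_eq hbc hps hρ (hv.continuous_dTau hf) (hv.dTau_ode hf)
    hv.dTau_one
  obtain ⟨d, hd, hd'⟩ := hX.exists_inner_eq hbc hps hρ (continuous_dPhi hv.c1) (hv.dPhi_ode hf)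
    hv.dPhi_one
  have hcT : c = T * ηT := by
    rw [← neg_add_eq_zero.1 hX.var_T.symm, ← cylInt_const_mul, ← cylInt_const c]
    congr 1
    funext z
    rw [← hc z, hv.dTau_eq, inner_smul_right]
  have hdρ : d = -ηρ := by
    have := hX.var_ρ
    simp only [hd'] at this
    simp only [integral_const, Measure.real, AddCircle.measure_univ] at this
    simp at this
    linarith
  obtain ⟨φ, τ⟩ := z
  refine ext_inner_right ℝ fun x => ?_
  -- Every test vector is `V u`, and pairings with `V u` do not depend on `τ`; this reduces the
  -- identity to `τ = 0`, where `htr` decides it.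
  obtain ⟨u, rfl⟩ := hV.surjective hf (φ, τ) x
  have htr := hX.inner_qtr_eq_zero hbc hps hV hnh φ u
  have hde := hX.inner_eq_initial hps (hV.apply_ode u φ) τ
  obtain ⟨h1, h2⟩ := hnh.q_transport hli hv hV hf φ τ u
  rw [hV.init, ContinuousLinearMap.id_apply] at hde
  rw [qtr, sub_apply, ContinuousLinearMap.id_apply, inner_sub_right,
    qtg_apply, inner_add_right, inner_smul_right, inner_smul_right, hc, hd] at htr
  rw [hde, inner_sub_left, inner_smul_left, inner_smul_left, h1, h2, RCLike.conj_to_real,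
    RCLike.conj_to_real, ← hcT]
  rw [hdρ] at htr
  linarith

lemma IsAdjointSolution.unique {Y : AdjointVars n m}
    (hX : IsAdjointSolution f p T ρ v k kp ηT ηρ X)
    (hY : IsAdjointSolution f p T ρ v k kp ηT ηρ Y) (hde : Y.de = X.de) (hps : Y.ps = X.ps) :
    Y = X := by
  refine AdjointVars.ext hde ?_ hps (ext_inner_right ℝ fun δp => ?_)
  · funext φ
    rw [← hX.bc_eq, ← hY.bc_eq, hde]
  · have h1 := hX.var_p δp
    have h2 := hY.var_p δp
    rw [hde, hps] at h2
    linarith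

/-- The explicit solution of the adjoint conditions. -/
lemma exists_isAdjointSolution (hli : TangentIndependent v) (hv : IsTorusSolution f p T ρ v)
    (hf : ContDiff ℝ 1 fun x : Vec n × Vec m => f x.1 x.2) (hV : IsVariational f p T v V)
    (hnh : IsNormallyHyperbolic ρ v V qτ qφ) (k : Fin 2 → C(Cyl, Vec n))
    (kp : Fin 2 → Vec m →L[ℝ] ℝ) (ηT ηρ : ℝ) :
    ∃ X : AdjointVars n m, IsAdjointSolution f p T ρ v k kp ηT ηρ X ∧ Continuous X.de ∧
      Continuous X.bc ∧ X.ps = 0 ∧ ∀ z, X.de z = (T * ηT) • qτ z - ηρ • qφ z := by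
  obtain ⟨hqτ, hqφ⟩ := hnh.continuous_q hli (hv.continuous_dTau hf) (continuous_dPhi hv.c1)
  set q : Cyl → Vec n := fun z => (T * ηT) • qτ z - ηρ • qφ z with hq
  have hqc : Continuous q := by fun_prop
  have hqshift : ∀ φ, q (φ, 1) = q (φ + (ρ : Circ), 0) := fun φ => by
    simp only [hq, (hnh.q_one hli hv φ).1, (hnh.q_one hli hv φ).2]
  -- With `T = 0` the vector `∂_τ v` would vanish, against independence. Nonvanishing is needed to
  -- write `f = T⁻¹ ∂_τ v` in the `η_T` condition.
  have hT : T ≠ 0 := by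
    rintro rfl
    have := hli (0, 0) 1 0 (by rw [hv.dTau_eq]; simp)
    exact one_ne_zero this.1
  have hdfp : Continuous fun z => dfp f (v z) p := (continuous_dfp hf p).comp v.continuous
  -- As `λ_ps = 0`, the last adjoint condition says that `η_p` is the Riesz representative of this
  -- functional.
  let L : Vec m →ₗ[ℝ] ℝ :=
    { toFun := fun δp => cylInt fun z => ⟪q z, T • dfp f (v z) p δp⟫
      map_add' := fun x y => by
        simp only [map_add, smul_add, inner_add_right]
        exact cylInt_add (by fun_prop) (by fun_prop)
      map_smul' := fun c x => by
        simp only [map_smul, smul_comm T c, inner_smul_right _ _ c]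
        exact cylInt_const_mul _ _ }
  refine ⟨⟨q, fun φ => q (φ, 1), 0,
    (InnerProductSpace.toDual ℝ (Vec m)).symm (LinearMap.toContinuousLinearMap L)⟩,
    ⟨fun φ τ => ?_, fun φ => ?_, fun φ => ?_, ?_, ?_, fun δp => ?_⟩, hqc, by fun_prop, rfl,
    fun z => rfl⟩
  · have := hV.adjoint_ode hf (q := q) (φ := φ) (fun τ u => by
      simp only [hq, inner_sub_left, inner_smul_left, (hnh.q_transport hli hv hV hf φ τ u).1,
        (hnh.q_transport hli hv hV hf φ τ u).2]) τ
    simpa using this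
  · simp
  · simp [hqshift]
  · have : (fun z => ⟪q z, f (v z) p⟫) = fun _ => ηT := by
      funext z
      have hfz : f (v z) p = T⁻¹ • dTau v z := by
        rw [hv.dTau_eq, smul_smul, inv_mul_cancel₀ hT, one_smul]
      rw [hfz, inner_smul_right, hq, inner_sub_left, inner_smul_left, inner_smul_left,
        (hnh.inner_dTau hli z).1, (hnh.inner_dTau hli z).2]
      simp [hT]
    simp only [this, cylInt_const]
    ring
  · have : ∀ φ : Circ, ⟪q (φ, 1), dPhi v (φ + (ρ : Circ), 0)⟫ = -ηρ := fun φ => by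
      rw [← hv.dPhi_one, hq, inner_sub_left, inner_smul_left, inner_smul_left,
        (hnh.inner_dPhi hli _).1, (hnh.inner_dPhi hli _).2]
      simp
    simp only [this, integral_const, Measure.real, AddCircle.measure_univ]
    simp
  · rw [InnerProductSpace.toDual_symm_apply]
    simp [L]

end Adjoint

/-! ### Unboundedness of the inverse of the linearized problem -/

section Linearization

/-- Take the real part of the character `e^{2πiNφ}` with `Nρ` close to an integer, by Dirichlet
approximation. Rotation by `ρ` multiplies the character by a factor close to `1`, while the values
`±1` are attained at `0` and at the half period `1/(2N)`. -/
lemma exists_almost_invariant (ρ : ℝ) {ε : ℝ} (hε : 0 < ε) :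
    ∃ g : Circ → ℝ, Continuous g ∧ (∀ φ, |g (φ + (ρ : Circ)) - g φ| ≤ ε) ∧
      (∃ φ, g φ = 1) ∧ ∃ φ, g φ = -1 := by
  obtain ⟨M, hM⟩ := exists_nat_gt (2 * Real.pi / ε)
  have hMpos : 0 < M := by
    have : (0 : ℝ) < M := lt_trans (by positivity) hM
    exact_mod_cast this
  obtain ⟨N, hN, -, hNρ⟩ := Real.exists_nat_abs_mul_sub_round_le ρ hMpos
  have hN' : (N : ℂ) ≠ 0 := by exact_mod_cast hN.ne'
  refine ⟨fun φ => (fourier (N : ℤ) φ).re, by fun_prop, fun φ => ?_, ⟨0, by simp⟩,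
    ⟨((1 / (2 * N) : ℝ) : Circ), ?_⟩⟩
  · have hmul : fourier (N : ℤ) (φ + (ρ : Circ)) =
        fourier (N : ℤ) φ * fourier (N : ℤ) (ρ : Circ) := by
      simp only [fourier_apply, smul_add, AddCircle.toCircle_add, Circle.coe_mul]
    have hexp : fourier (N : ℤ) (ρ : Circ) =
        Complex.exp (Complex.I * ((2 * Real.pi * (N * ρ - round (N * ρ)) : ℝ) : ℂ)) := by
      rw [fourier_coe_apply, Complex.exp_eq_exp_iff_exists_int]
      refine ⟨round (N * ρ), ?_⟩
      push_cast
      ring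
    have hnorm : ‖fourier (N : ℤ) (ρ : Circ) - 1‖ ≤ ε := by
      rw [hexp]
      refine (Real.norm_exp_I_mul_ofReal_sub_one_le).trans ?_
      rw [Real.norm_eq_abs, abs_mul, abs_of_pos Real.two_pi_pos]
      have hM1 : (0 : ℝ) < M + 1 := by positivity
      calc 2 * Real.pi * |N * ρ - round (N * ρ)| ≤ 2 * Real.pi * (1 / (M + 1)) := by gcongr
        _ ≤ ε := by
          rw [mul_one_div, div_le_iff₀ hM1]
          rw [div_lt_iff₀ hε] at hM
          nlinarith
    rw [← Complex.sub_re]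
    refine (Complex.abs_re_le_norm _).trans ?_
    rw [hmul, ← mul_sub_one, norm_mul]
    rwa [fourier_apply (n := (N : ℤ)) (x := φ), Circle.norm_coe, one_mul]
  · have : 2 * (Real.pi : ℂ) * Complex.I * ((N : ℤ) : ℂ) * ((1 / (2 * N) : ℝ) : ℂ) / ((1 : ℝ) : ℂ) =
        Real.pi * Complex.I := by
      push_cast
      field_simp
    change (fourier (N : ℤ) ((1 / (2 * N) : ℝ) : Circ)).re = -1
    rw [fourier_coe_apply, this, Complex.exp_pi_mul_I]
    simp

variable {n m : ℕ} {f : Vec n → Vec m → Vec n} {p : Vec m} {T ρ : ℝ} {v : C(Cyl, Vec n)}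
  {V : Cyl → Vec n →L[ℝ] Vec n} {qτ qφ : Cyl → Vec n} {k : Fin 2 → C(Cyl, Vec n)}

/-- Modulating the tangent field `∂_φ v` by an almost invariant function, and correcting the phase
conditions by tangent fields, refutes every bound for the linearized problem. -/
lemma not_linearizationBound (hli : TangentIndependent v) (hv : IsTorusSolution f p T ρ v)
    (hf : ContDiff ℝ 1 fun x : Vec n × Vec m => f x.1 x.2)
    (hnh : IsNormallyHyperbolic ρ v V qτ qφ) (hdet : (phaseMatrix k v).det ≠ 0)
    (kp : Fin 2 → Vec m →L[ℝ] ℝ) (C : ℝ) : ¬ LinearizationBound f p T ρ v k kp C := by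
  intro hbound
  have hτ := hv.continuous_dTau hf
  have hφ := continuous_dPhi hv.c1
  obtain ⟨-, hqφ⟩ := hnh.continuous_q hli hτ hφ
  obtain ⟨K, hK⟩ := isCompact_univ.exists_bound_of_continuousOn hqφ.continuousOn
  obtain ⟨B, hB⟩ := isCompact_univ.exists_bound_of_continuousOn hφ.continuousOn
  -- With `K` bounding `q_φ`, this makes the claimed bound `C * ε` on `δ_v` force the `∂_φ
  -- v`-coefficient of `δ_v` below `1`. The factor `|B| + 1` below absorbs the size of `∂_φ v` in
  -- the boundary defect.
  set ε : ℝ := 1 / (|K * C| + 1) with hε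
  have hεpos : 0 < ε := by positivity
  have hKC : K * (C * ε) < 1 := by
    rw [hε, ← mul_assoc, mul_one_div, div_lt_one (by positivity)]
    exact (le_abs_self _).trans_lt (lt_add_one _)
  obtain ⟨g, hg, hinv, ⟨φ₁, h₁⟩, φ₂, h₂⟩ := exists_almost_invariant ρ
    (ε := ε / (|B| + 1)) (by positivity)
  -- The tangential correction makes both phase conditions vanish exactly and adds nothing to the
  -- boundary defect. Since `g` depends on `φ` alone, `δ` solves the variational equation exactly,
  -- so the only defect is in the boundary condition.
  set c : Fin 2 → ℝ := (phaseMatrix k v)⁻¹.mulVec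
    fun i => -cylInt fun z => ⟪k i z, g z.1 • dPhi v z⟫ with hc
  have hMc : (phaseMatrix k v).mulVec c =
      fun i => -cylInt fun z => ⟪k i z, g z.1 • dPhi v z⟫ := by
    rw [hc, Matrix.mulVec_mulVec, Matrix.mul_nonsing_inv _ (isUnit_iff_ne_zero.2 hdet),
      Matrix.one_mulVec]
  let δ : C(Cyl, Vec n) :=
    ⟨fun z => g z.1 • dPhi v z + (c 0 • dTau v z + c 1 • dPhi v z), by fun_prop⟩
  have hode : ∀ φ (τ : unitInterval),
      HasDerivWithinAt (slice δ φ) (jac f p T v (φ, τ) (δ (φ, τ))) (Icc 0 1) (τ : ℝ) := by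
    intro φ τ
    have := ((hv.dPhi_ode hf φ τ).const_smul (g φ)).add
      (((hv.dTau_ode hf φ τ).const_smul (c 0)).add ((hv.dPhi_ode hf φ τ).const_smul (c 1)))
    simp only [δ, ContinuousMap.coe_mk, map_add, map_smul]
    exact this
  have hdτ : ∀ z, dTau δ z = jac f p T v z (δ z) := fun z =>
    dTau_eq_of_hasDerivWithinAt (hode z.1 z.2)
  have hδ : HasContDTau δ := ⟨fun z => (hode z.1 z.2).differentiableWithinAt,
    ((continuous_jac hf p T v).clm_apply δ.continuous).congr fun z => (hdτ z).symm⟩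
  have hlin := (hbound δ 0 0 0 ε hδ (fun z => ?_) (fun φ => ?_) (fun i => ?_)
    (by simpa using hεpos.le)).1
  -- Pairing with `q_φ` extracts the coefficient `g + c 1`. As `g` takes both values `1` and `-1`,
  -- no constant `c 1` keeps it below `1` in absolute value.
  · have hcoef : ∀ z : Cyl, |g z.1 + c 1| < 1 := by
      intro z
      have : ⟪qφ z, δ z⟫ = g z.1 + c 1 := by
        simp only [δ, ContinuousMap.coe_mk, inner_add_right, inner_smul_right,
          (hnh.inner_dPhi hli z).2, (hnh.inner_dTau hli z).2]
        ring
      rw [← this]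
      calc |⟪qφ z, δ z⟫| ≤ ‖qφ z‖ * ‖δ z‖ := abs_real_inner_le_norm _ _
        _ ≤ K * (C * ε) := mul_le_mul (hK z (mem_univ z)) (hlin z) (norm_nonneg _)
          ((norm_nonneg _).trans (hK z (mem_univ z)))
        _ < 1 := hKC
    have e₁ := abs_lt.1 (hcoef (φ₁, 0))
    have e₂ := abs_lt.1 (hcoef (φ₂, 0))
    simp only [h₁, h₂] at e₁ e₂
    linarith [e₁.2, e₂.1]
  · rw [linOde, hdτ]
    simpa [jac] using hεpos.le
  · have : linBc ρ v δ 0 φ = (g (φ + (ρ : Circ)) - g φ) • dPhi v (φ + (ρ : Circ), 0) := by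
      simp only [linBc, δ, ContinuousMap.coe_mk, hv.dTau_one, hv.dPhi_one, zero_smul, add_zero,
        sub_smul]
      abel
    rw [this, norm_smul, Real.norm_eq_abs]
    calc |g (φ + (ρ : Circ)) - g φ| * ‖dPhi v (φ + (ρ : Circ), 0)‖
        ≤ ε / (|B| + 1) * (|B| + 1) := by
          refine mul_le_mul (hinv φ) ?_ (norm_nonneg _) (by positivity)
          exact (hB _ (mem_univ _)).trans
            ((le_abs_self B).trans (le_add_of_nonneg_right zero_le_one))
      _ = ε := div_mul_cancel₀ _ (by positivity)
  · have h1 : linPhase k kp δ 0 i = 0 := by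
      have hi := congrFun hMc i
      simp only [phaseMatrix, Matrix.mulVec, dotProduct, Fin.sum_univ_two, Matrix.of_apply,
        Matrix.cons_val_zero, Matrix.cons_val_one] at hi
      simp only [linPhase, δ, ContinuousMap.coe_mk, map_zero, add_zero]
      simp only [inner_add_right (𝕜 := ℝ) _ (g _ • dPhi v _)]
      rw [cylInt_add (by fun_prop) (by fun_prop),
        cylInt_inner_combination (k i).continuous hτ hφ, hi]
      ring
    rw [h1, abs_zero]
    exact hεpos.le

end Linearization

end QPTorus

end

/-! ### The main theorem -/

theorem mainTheorem1 {n m : ℕ}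
    (f : QPTorus.Vec n → QPTorus.Vec m → QPTorus.Vec n)
    (hf : ContDiff ℝ 1 (fun x : QPTorus.Vec n × QPTorus.Vec m => f x.1 x.2))
    (p : QPTorus.Vec m) (T ρ : ℝ) (hρ : Irrational ρ)
    (v : C(QPTorus.Cyl, QPTorus.Vec n))
    (hv : QPTorus.IsTorusSolution f p T ρ v)
    (h : Fin 2 → C(QPTorus.Cyl, QPTorus.Vec n) → QPTorus.Vec m → ℝ)
    (hphase : ∀ i, h i v p = 0)
    (k : Fin 2 → C(QPTorus.Cyl, QPTorus.Vec n))
    (kp : Fin 2 → QPTorus.Vec m →L[ℝ] ℝ)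
    (hk : QPTorus.IsPhaseDeriv h v p k kp)
    (hnondeg : (QPTorus.phaseMatrix k v).det ≠ 0)
    (V : QPTorus.Cyl → QPTorus.Vec n →L[ℝ] QPTorus.Vec n)
    (hV : QPTorus.IsVariational f p T v V)
    (qτ qφ : QPTorus.Cyl → QPTorus.Vec n)
    (hnh : QPTorus.IsNormallyHyperbolic ρ v V qτ qφ) :
    -- every solution of the adjoint conditions that is continuous in `φ`
    (∀ (ηT ηρ : ℝ) (X : QPTorus.AdjointVars n m),
      QPTorus.IsAdjointSolution f p T ρ v k kp ηT ηρ X → Continuous X.bc →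
        X.ps = 0 ∧ ∀ z, X.de z = (T * ηT) • qτ z - ηρ • qφ z) ∧
    -- existence and uniqueness for `(η_T, η_ρ) = (1, 0)`
    (∃ X : QPTorus.AdjointVars n m,
      QPTorus.IsAdjointSolution f p T ρ v k kp 1 0 X ∧ Continuous X.de ∧ Continuous X.bc ∧
        (∀ z, X.de z = T • qτ z) ∧
        ∀ Y, QPTorus.IsAdjointSolution f p T ρ v k kp 1 0 Y → Continuous Y.bc → Y = X) ∧
    -- existence and uniqueness for `(η_T, η_ρ) = (0, 1)`
    (∃ X : QPTorus.AdjointVars n m,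
      QPTorus.IsAdjointSolution f p T ρ v k kp 0 1 X ∧ Continuous X.de ∧ Continuous X.bc ∧
        (∀ z, X.de z = -qφ z) ∧
        ∀ Y, QPTorus.IsAdjointSolution f p T ρ v k kp 0 1 Y → Continuous Y.bc → Y = X) ∧
    -- the linearized problem has no bounded inverse
    ¬ ∃ C : ℝ, QPTorus.LinearizationBound f p T ρ v k kp C := by
  have hli : QPTorus.TangentIndependent v := hv.tangent_independent hf hρ hnondeg
  have hsol : ∀ (ηT ηρ : ℝ) (X : QPTorus.AdjointVars n m),
      QPTorus.IsAdjointSolution f p T ρ v k kp ηT ηρ X → Continuous X.bc →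
        X.ps = 0 ∧ ∀ z, X.de z = (T * ηT) • qτ z - ηρ • qφ z := fun ηT ηρ X hX hbc =>
    have hps := hX.ps_eq_zero hbc hv hf hnondeg
    ⟨hps, hX.de_eq hbc hps hρ hli hv hf hV hnh⟩
  have huniq : ∀ (ηT ηρ : ℝ), ∃ X : QPTorus.AdjointVars n m,
      QPTorus.IsAdjointSolution f p T ρ v k kp ηT ηρ X ∧ Continuous X.de ∧ Continuous X.bc ∧
        (∀ z, X.de z = (T * ηT) • qτ z - ηρ • qφ z) ∧
        ∀ Y, QPTorus.IsAdjointSolution f p T ρ v k kp ηT ηρ Y → Continuous Y.bc → Y = X := by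
    intro ηT ηρ
    obtain ⟨X, hX, hde, hbc, hps, hq⟩ :=
      QPTorus.exists_isAdjointSolution hli hv hf hV hnh k kp ηT ηρ
    refine ⟨X, hX, hde, hbc, hq, fun Y hY hYbc => ?_⟩
    obtain ⟨hYps, hYq⟩ := hsol ηT ηρ Y hY hYbc
    exact hX.unique hY (funext fun z => (hYq z).trans (hq z).symm) (hYps.trans hps.symm)
  refine ⟨hsol, ?_, ?_, fun ⟨C, hC⟩ =>
    QPTorus.not_linearizationBound hli hv hf hnh hnondeg kp C hC⟩
  · simpa using huniq 1 0
  · simpa using huniq 0 1
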